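/- There exist absolute constants $c,C\in(0,\infty)$ such that the following holds. Let $n,N,\ell\in\mathbb N$ with $1\leq \ell\leq N$, let $q\in[1,\infty)$, let $X_1,\dots,X_N$ be independent and identically distributed random vectors in $\mathbb R^n$ on a probability space, and let $\theta\in\mathbb S^{n-1}$. For $1\le r<\infty$ put $$h_{K_{N,\ell,r}}(\theta):=\left(\frac1\ell\sum_{k=1}^{\ell}\operatorname*{k\text{-}max}_{1\leq i\leq N}|\langle X_i,\theta\rangle|^r\right)^{1/r},$$ where $\operatorname*{k\text{-}max}_{1\le i\le N}a_i$ denotes the $k$-th largest of the numbers $a_1,\dots,a_N$, counted with multiplicity; this is the value in direction $\theta$ of the support function of the random convex body $K_{N,\ell,r}$. Then $$c\,\mathbb E\max_{1\leq i\leq\lfloor N/\ell\rfloor}|\langle X_i,\theta\rangle|\ \leq\ \mathbb E\,h_{K_{N,\ell,1}}(\theta)\ \leq\ \mathbb E\,h_{K_{N,\ell,q}}(\theta)\ \leq\ C\left(\mathbb E\max_{1\leq i\leq\lceil N/\ell\rceil}|\langle X_i,\theta\rangle|^q\right)^{1/q}.$$ Here expectations of nonnegative random variables are taken in $[0,\infty]$,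 so no integrability is assumed. -/

import Mathlib

open MeasureTheory ProbabilityTheory
open scoped ENNReal NNReal

noncomputable section

/-- The decreasing rearrangement of a finite family of reals: `kMax a j` is the `(j+1)`-st largest
of the numbers `a 0, …, a (N-1)`, counted with multiplicity. -/
def kMax {N : ℕ} (a : Fin N → ℝ) (j : Fin N) : ℝ :=
  a (Tuple.sort (fun i => -a i) j)

/-- The support function, in direction `θ`, of the convex body `K_{N,ℓ,q}` generated by the
vectors `x 0, …, x (N-1)`:
`((1/ℓ) ∑_{k=1}^ℓ k-max_{i} |⟨x i, θ⟩|^q)^{1/q}`. -/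
def supportK {n N : ℕ} (ℓ : ℕ) (q : ℝ) (x : Fin N → EuclideanSpace ℝ (Fin n))
    (θ : EuclideanSpace ℝ (Fin n)) : ℝ :=
  ((1 / (ℓ : ℝ)) * ∑ k ∈ (Finset.univ : Finset (Fin N)).filter (fun k => k.val < ℓ),
      kMax (fun i => |inner ℝ (x i) θ| ^ q) k)
    ^ (1 / q)

/-- The maximum of the first `m` members of a family of nonnegative reals,
as an element of `[0,∞]`. -/
def maxFirst {N : ℕ} (m : ℕ) (a : Fin N → ℝ) : ℝ≥0∞ :=
  ⨆ i : Fin N, ⨆ _ : (i : ℕ) < m, ENNReal.ofReal (a i)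

end

/-!
Write `Y i = |⟨X i, θ⟩|`, so that the support function is built from the sum `S a` of the `ℓ` largest
members of a family `a`. Everything rests on the description of `S a` as the largest of the sums
`∑ i ∈ A, a i` over index sets `A` with `ℓ` elements (`exists_card_eq_and_sum_kMax_eq`,
`sum_le_sum_kMax`).

*Lower bound* (with `c = 1`). If `m * ℓ ≤ N`, the index set contains `ℓ` disjoint blocks of `m`
indices. Choosing in each block an index of a maximal member gives `ℓ` indices, so `S Y` is at least
the sum of the `ℓ` block maxima (`sum_iSup_block_le_sum_kMax`), and these all have the same
expectation as the maximum of the first `m` variables.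

*Monotonicity in `q`* is the power mean inequality on a set `A` attaining `S Y`.

*Upper bound* (with `C = 2`). By Jensen's inequality it suffices to bound the expectation of `S Z`,
`Z i = Y i ^ q`. Let `p s` be the probability that `Z i` exceeds `s`. Writing every `Z i` as an
integral of indicators `1_{s < Z i}` over `s > 0` gives
`S Z ≤ ∫ min (ℓ, #{i | s < Z i}) ds`, whence `𝔼 S Z ≤ ℓ ∫ min (1, M * p s) ds` if `N ≤ M * ℓ`
(`lintegral_min_count_le`). On the other hand the expectation of the maximum of `M` of the variables
is `∫ (1 - (1 - p s) ^ M) ds` (`lintegral_iSup_ofReal_eq`), and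
`min (1, M * p) ≤ 2 * (1 - (1 - p) ^ M)` for every `p ∈ [0, 1]`.
No integrability enters, since all of this takes place in `[0, ∞]`.
-/

/-! ### Sums of the largest members of a family -/

open Finset in
theorem exists_card_eq_and_sum_kMax_eq {N ℓ : ℕ} (hℓ : ℓ ≤ N) (a : Fin N → ℝ) :
    ∃ A : Finset (Fin N), A.card = ℓ ∧
      ∑ k ∈ (univ : Finset (Fin N)).filter (fun k => k.val < ℓ), kMax a k = ∑ i ∈ A, a i := by
  refine ⟨((univ : Finset (Fin N)).filter (fun k => k.val < ℓ)).map
    (Tuple.sort (fun i => -a i)).toEmbedding, ?_, ?_⟩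
  · rw [card_map, Fin.card_filter_val_lt, min_eq_right hℓ]
  · rw [sum_map]; rfl

open Finset in
theorem sum_le_sum_kMax {N ℓ : ℕ} (a : Fin N → ℝ) (A : Finset (Fin N)) (hA : A.card = ℓ) :
    ∑ i ∈ A, a i ≤ ∑ k ∈ (univ : Finset (Fin N)).filter (fun k => k.val < ℓ), kMax a k := by
  have hℓN : ℓ ≤ N := by simpa [hA] using card_le_univ A
  rcases Nat.eq_zero_or_pos ℓ with h0 | h0
  · subst h0
    simp [card_eq_zero.mp hA]
  set σ := Tuple.sort (fun i => -a i) with hσ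
  have hanti : ∀ i j, i ≤ j → kMax a j ≤ kMax a i := fun i j hij => by
    have := Tuple.monotone_sort (fun i => -a i) hij
    simp only [Function.comp] at this
    unfold kMax
    linarith
  set T := (univ : Finset (Fin N)).filter (fun k => k.val < ℓ) with hT
  have hTc : T.card = ℓ := by rw [hT, Fin.card_filter_val_lt, min_eq_right hℓN]
  set B := A.map σ.symm.toEmbedding with hB
  have hBc : B.card = ℓ := by rw [hB, card_map, hA]
  have hBs : ∑ i ∈ A, a i = ∑ k ∈ B, kMax a k := by
    rw [hB, sum_map]
    simp [kMax, ← hσ]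
  rw [hBs]
  -- Compare both sums after subtracting the `ℓ`-th largest member `t` from every summand:
  -- the summands with index in `T` become nonnegative, the others nonpositive.
  set t := kMax a ⟨ℓ - 1, by omega⟩ with ht
  have key : ∑ k ∈ B, (kMax a k - t) ≤ ∑ k ∈ T, (kMax a k - t) := by
    calc ∑ k ∈ B, (kMax a k - t) ≤ ∑ k ∈ B ∩ T, (kMax a k - t) := by
          rw [← sum_inter_add_sum_sdiff B T]
          have : ∑ k ∈ B \ T, (kMax a k - t) ≤ 0 := sum_nonpos fun k hk => by
            have hk' : ¬ k.val < ℓ := by simpa [hT] using (mem_sdiff.mp hk).2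
            have := hanti ⟨ℓ - 1, by omega⟩ k (by rw [Fin.le_def]; simp only; omega)
            linarith
          linarith
      _ ≤ ∑ k ∈ T, (kMax a k - t) :=
          sum_le_sum_of_subset_of_nonneg inter_subset_right fun k hk _ => by
            have hk' : k.val < ℓ := by simpa [hT] using hk
            have := hanti k ⟨ℓ - 1, by omega⟩ (by rw [Fin.le_def]; simp only; omega)
            linarith
  simp only [sum_sub_distrib, sum_const, hBc, hTc] at key
  linarith

/-- The indices `(j, r)` stand for the `r`-th index of the `j`-th block. -/
theorem sum_iSup_block_le_sum_kMax {N ℓ m : ℕ} (a : Fin N → ℝ) (ha : ∀ i, 0 ≤ a i)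
    (e : Fin ℓ × Fin m → Fin N) (he : Function.Injective e) :
    ∑ j : Fin ℓ, ⨆ r : Fin m, ENNReal.ofReal (a (e (j, r))) ≤
      ENNReal.ofReal
        (∑ k ∈ (Finset.univ : Finset (Fin N)).filter (fun k => k.val < ℓ), kMax a k) := by
  rcases Nat.eq_zero_or_pos m with h0 | h0
  · subst h0
    simp
  have : Nonempty (Fin m) := ⟨⟨0, h0⟩⟩
  choose r hr using fun j : Fin ℓ =>
    exists_eq_ciSup_of_finite (f := fun r : Fin m => ENNReal.ofReal (a (e (j, r))))
  have hinj : Function.Injective fun j => e (j, r j) := fun i j hij =>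
    congrArg Prod.fst (he hij)
  have h := sum_le_sum_kMax a (Finset.univ.map ⟨_, hinj⟩) (by simp : _ = ℓ)
  rw [Finset.sum_map] at h
  calc ∑ j : Fin ℓ, ⨆ r : Fin m, ENNReal.ofReal (a (e (j, r)))
      = ∑ j : Fin ℓ, ENNReal.ofReal (a (e (j, r j))) := Finset.sum_congr rfl fun j _ => (hr j).symm
    _ = ENNReal.ofReal (∑ j : Fin ℓ, a (e (j, r j))) :=
        (ENNReal.ofReal_sum_of_nonneg fun _ _ => ha _).symm
    _ ≤ _ := ENNReal.ofReal_le_ofReal h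

theorem maxFirst_eq_iSup_castLE {N m : ℕ} (hm : m ≤ N) (a : Fin N → ℝ) :
    maxFirst m a = ⨆ r : Fin m, ENNReal.ofReal (a (Fin.castLE hm r)) := by
  refine le_antisymm (iSup₂_le fun i hi => ?_) (iSup_le fun r => ?_)
  · exact le_iSup_of_le (⟨i, hi⟩ : Fin m) le_rfl
  · exact le_iSup₂_of_le (Fin.castLE hm r) r.2 le_rfl

/-! ### Layer cake representations -/

theorem min_one_mul_le_two_mul_one_sub_pow (M : ℕ) {p : ℝ≥0∞} (hp : p ≤ 1) :
    min 1 (M * p) ≤ 2 * (1 - (1 - p) ^ M) := by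
  lift p to ℝ≥0 using ne_top_of_le_ne_top ENNReal.one_ne_top hp
  have hp' : p ≤ 1 := by exact_mod_cast hp
  have key : min 1 (M * p) ≤ 2 * (1 - (1 - p) ^ M) := by
    have hp1 : (p : ℝ) ≤ 1 := by exact_mod_cast hp'
    have hp0 : (0 : ℝ) ≤ p := p.2
    have hpow : (1 - p) ^ M ≤ 1 := pow_le_one₀ zero_le tsub_le_self
    rw [← NNReal.coe_le_coe]
    push_cast [NNReal.coe_sub hpow, NNReal.coe_sub hp']
    -- `(1 - p) ^ M * (1 + M * p) ≤ (1 - p) ^ M * (1 + p) ^ M = (1 - p ^ 2) ^ M ≤ 1`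
    have hB : 1 + (M : ℝ) * p ≤ (1 + (p : ℝ)) ^ M :=
      one_add_mul_le_pow (by linarith) M
    have hy0 : 0 ≤ (1 - (p : ℝ)) ^ M := pow_nonneg (by linarith) M
    have h1 : (1 - (p : ℝ)) ^ M * (1 + M * p) ≤ 1 := by
      refine (mul_le_mul_of_nonneg_left hB hy0).trans ?_
      rw [← mul_pow]
      exact pow_le_one₀ (by nlinarith) (by nlinarith)
    have hx : (0 : ℝ) ≤ M * p := by positivity
    rcases le_total ((M : ℝ) * p) 1 with h | h
    · rw [min_eq_right h]; nlinarith
    · rw [min_eq_left h]; nlinarith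
  exact_mod_cast key

theorem ofReal_eq_lintegral_indicator (a : ℝ) :
    ENNReal.ofReal a = ∫⁻ s in Set.Ioi (0 : ℝ), (Set.Iio a).indicator 1 s := by
  rw [lintegral_indicator_one measurableSet_Iio, Measure.restrict_apply measurableSet_Iio,
    Set.inter_comm, Set.Ioi_inter_Iio, Real.volume_Ioo, sub_zero]

theorem iSup_ofReal_eq_measure {κ : Type*} [Finite κ] (a : κ → ℝ) :
    ⨆ k, ENNReal.ofReal (a k) = volume.restrict (Set.Ioi (0 : ℝ)) {s | ∃ k, s < a k} := by
  have hvol : ∀ k, ENNReal.ofReal (a k) = volume.restrict (Set.Ioi (0 : ℝ)) (Set.Iio (a k)) :=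
    fun k => by
      rw [ofReal_eq_lintegral_indicator, lintegral_indicator_one measurableSet_Iio]
  simp only [hvol]
  refine le_antisymm (iSup_le fun k => measure_mono fun s hs => ⟨k, hs⟩) ?_
  rcases isEmpty_or_nonempty κ with h | h
  · simp
  obtain ⟨k, hk⟩ := Finite.exists_max a
  exact le_iSup_of_le k (measure_mono fun s ⟨j, hj⟩ => lt_of_lt_of_le hj (hk j))

/-! ### Expectations of maxima and of sums of the largest members -/

section Probability

variable {Ω : Type*} [MeasurableSpace Ω] {P : Measure Ω} [IsProbabilityMeasure P]

theorem measure_exists_lt_eq {κ : Type*} [Fintype κ] {W : κ → Ω → ℝ}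
    (hW : ∀ k, Measurable (W k)) (hind : iIndepFun W P) {s : ℝ} {p : ℝ≥0∞}
    (hp : ∀ k, P {ω | s < W k ω} = p) :
    P {ω | ∃ k, s < W k ω} = 1 - (1 - p) ^ Fintype.card κ := by
  have hk : ∀ k, P (W k ⁻¹' Set.Iic s) = 1 - p := fun k => by
    rw [← hp k, ← prob_compl_eq_one_sub (measurableSet_lt measurable_const (hW k))]
    congr 1
    ext ω
    simp
  have hall : P (⋂ k ∈ (Finset.univ : Finset κ), W k ⁻¹' Set.Iic s) =
      (1 - p) ^ Fintype.card κ := by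
    rw [hind.measure_inter_preimage_eq_mul _ fun _ _ => measurableSet_Iic]
    simp [hk]
  have hm : MeasurableSet (⋂ k ∈ (Finset.univ : Finset κ), W k ⁻¹' Set.Iic s) :=
    Finset.measurableSet_biInter _ fun k _ => hW k measurableSet_Iic
  rw [← hall, ← prob_compl_eq_one_sub hm]
  congr 1
  ext ω
  simp

/-- The layer cake formula for the maximum of independent variables with a common tail function
`p`. -/
theorem lintegral_iSup_ofReal_eq {κ : Type*} [Fintype κ] {W : κ → Ω → ℝ}
    (hW : ∀ k, Measurable (W k)) (hind : iIndepFun W P) {p : ℝ → ℝ≥0∞}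
    (hp : ∀ k s, P {ω | s < W k ω} = p s) :
    ∫⁻ ω, ⨆ k, ENNReal.ofReal (W k ω) ∂P =
      ∫⁻ s in Set.Ioi (0 : ℝ), (1 - (1 - p s) ^ Fintype.card κ) := by
  have hm : MeasurableSet {x : Ω × ℝ | ∃ k, x.2 < W k x.1} := by
    rw [Set.ofPred_exists]
    exact .iUnion fun k => measurableSet_lt measurable_snd ((hW k).comp measurable_fst)
  simp only [iSup_ofReal_eq_measure]
  refine (Measure.prod_apply hm).symm.trans ((Measure.prod_apply_symm hm).trans ?_)
  exact lintegral_congr fun s => measure_exists_lt_eq hW hind fun k => hp k s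

/-- The number of members of the family `a` exceeding `s`, as an element of `[0, ∞]`. -/
noncomputable def countAbove {N : ℕ} (a : Fin N → ℝ) (s : ℝ) : ℝ≥0∞ :=
  ∑ i, (Set.Iio (a i)).indicator 1 s

theorem measurable_min_countAbove {N : ℕ} (ℓ : ℕ) {Z : Fin N → Ω → ℝ}
    (hZ : ∀ i, Measurable (Z i)) :
    Measurable fun x : Ω × ℝ => min (ℓ : ℝ≥0∞) (countAbove (fun i => Z i x.1) x.2) := by
  refine measurable_const.min (Finset.measurable_sum _ fun i _ => ?_)
  have hm : MeasurableSet {x : Ω × ℝ | x.2 < Z i x.1} :=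
    measurableSet_lt measurable_snd ((hZ i).comp measurable_fst)
  exact (measurable_one (α := ℝ≥0∞)).indicator hm

theorem ofReal_sum_kMax_le_lintegral_min {N ℓ : ℕ} (hℓ : ℓ ≤ N) (a : Fin N → ℝ)
    (ha : ∀ i, 0 ≤ a i) :
    ENNReal.ofReal
        (∑ k ∈ (Finset.univ : Finset (Fin N)).filter (fun k => k.val < ℓ), kMax a k) ≤
      ∫⁻ s in Set.Ioi (0 : ℝ), min (ℓ : ℝ≥0∞) (countAbove a s) := by
  obtain ⟨A, hA, hs⟩ := exists_card_eq_and_sum_kMax_eq hℓ a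
  rw [hs, ENNReal.ofReal_sum_of_nonneg fun i _ => ha i]
  simp only [ofReal_eq_lintegral_indicator]
  rw [← lintegral_finsetSum _ fun i _ =>
    (measurable_one (α := ℝ≥0∞)).indicator measurableSet_Iio]
  refine lintegral_mono fun s => le_min ?_ ?_
  · calc ∑ i ∈ A, (Set.Iio (a i)).indicator (1 : ℝ → ℝ≥0∞) s ≤ ∑ i ∈ A, 1 :=
          Finset.sum_le_sum fun i _ => Set.indicator_le_self' (fun _ _ => zero_le) s
      _ = ℓ := by simp [hA]
  · exact Finset.sum_le_sum_of_subset (Finset.subset_univ A)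

theorem lintegral_min_count_le {N ℓ M : ℕ} (hM : N ≤ M * ℓ) {Z : Fin N → Ω → ℝ}
    (hZ : ∀ i, Measurable (Z i)) {p : ℝ → ℝ≥0∞} (hp : ∀ i s, P {ω | s < Z i ω} = p s) :
    ∫⁻ ω, (∫⁻ s in Set.Ioi (0 : ℝ), min (ℓ : ℝ≥0∞) (countAbove (fun i => Z i ω) s)) ∂P ≤
      ℓ * ∫⁻ s in Set.Ioi (0 : ℝ), min 1 (M * p s) := by
  rw [lintegral_lintegral_swap (measurable_min_countAbove ℓ hZ).aemeasurable,
    ← lintegral_const_mul' _ _ (ENNReal.natCast_ne_top ℓ)]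
  refine lintegral_mono fun s => ?_
  have hcount : ∫⁻ ω, countAbove (fun i => Z i ω) s ∂P = N * p s := by
    have hm : ∀ i, MeasurableSet {ω | s < Z i ω} := fun i =>
      measurableSet_lt measurable_const (hZ i)
    have h : ∀ i, ∫⁻ ω, (Set.Iio (Z i ω)).indicator (1 : ℝ → ℝ≥0∞) s ∂P = p s := fun i => by
      rw [← hp i s, ← lintegral_indicator_one (hm i)]
      rfl
    have hmeas : ∀ i, Measurable fun ω => (Set.Iio (Z i ω)).indicator (1 : ℝ → ℝ≥0∞) s :=
      fun i => (measurable_one (α := ℝ≥0∞)).indicator (hm i)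
    unfold countAbove
    rw [lintegral_finsetSum _ fun i _ => hmeas i]
    simp [h]
  calc ∫⁻ ω, min (ℓ : ℝ≥0∞) (countAbove (fun i => Z i ω) s) ∂P
      ≤ min (ℓ : ℝ≥0∞) (N * p s) := by
        refine le_min ?_ ?_
        · exact (lintegral_mono fun ω => min_le_left _ _).trans (by simp)
        · exact (lintegral_mono fun ω => min_le_right _ _).trans hcount.le
    _ ≤ min (ℓ : ℝ≥0∞) (ℓ * (M * p s)) := by
        refine min_le_min_left _ ?_
        rw [← mul_assoc]
        gcongr
        rw [mul_comm]
        exact_mod_cast hM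
    _ = ℓ * min 1 (M * p s) := by
        rw [mul_min, mul_one]

theorem lintegral_rpow_one_div_le {f : Ω → ℝ≥0∞} (hf : Measurable f) {q : ℝ} (hq : 1 ≤ q) :
    ∫⁻ ω, f ω ^ (1 / q) ∂P ≤ (∫⁻ ω, f ω ∂P) ^ (1 / q) := by
  have h := eLpNorm'_le_eLpNorm'_of_exponent_le one_pos hq P
    (hf.pow_const (1 / q)).aestronglyMeasurable
  have hq0 : q ≠ 0 := by positivity
  simpa [eLpNorm', ← ENNReal.rpow_mul, hq0] using h

theorem lintegral_maxFirst_le_lintegral_sum_kMax {N ℓ m : ℕ} (hℓ : 1 ≤ ℓ) (hm : m * ℓ ≤ N)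
    {Y : Fin N → Ω → ℝ} (hY : ∀ i, Measurable (Y i)) (hY0 : ∀ i ω, 0 ≤ Y i ω)
    (hind : iIndepFun Y P) {p : ℝ → ℝ≥0∞} (hp : ∀ i s, P {ω | s < Y i ω} = p s) :
    ℓ * ∫⁻ ω, maxFirst m (fun i => Y i ω) ∂P ≤
      ∫⁻ ω, ENNReal.ofReal
        (∑ k ∈ (Finset.univ : Finset (Fin N)).filter (fun k => k.val < ℓ),
          kMax (fun i => Y i ω) k) ∂P := by
  have hmN : m ≤ N := (Nat.le_mul_of_pos_right m hℓ).trans hm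
  set e : Fin ℓ × Fin m → Fin N := fun x =>
    Fin.castLE (by rwa [mul_comm]) (finProdFinEquiv x) with he
  have heinj : Function.Injective e :=
    (Fin.castLE_injective _).comp finProdFinEquiv.injective
  have hblock : ∀ j : Fin ℓ, ∫⁻ ω, ⨆ r : Fin m, ENNReal.ofReal (Y (e (j, r)) ω) ∂P =
      ∫⁻ ω, maxFirst m (fun i => Y i ω) ∂P := fun j => by
    simp only [maxFirst_eq_iSup_castLE hmN]
    rw [lintegral_iSup_ofReal_eq (W := fun r => Y (e (j, r))) (fun r => hY _)
        (hind.precomp (heinj.comp (Prod.mk_right_injective j))) (fun r => hp _),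
      lintegral_iSup_ofReal_eq (W := fun r => Y (Fin.castLE hmN r)) (fun r => hY _)
        (hind.precomp (Fin.castLE_injective hmN)) (fun r => hp _)]
  calc ℓ * ∫⁻ ω, maxFirst m (fun i => Y i ω) ∂P
      = ∫⁻ ω, ∑ j : Fin ℓ, ⨆ r : Fin m, ENNReal.ofReal (Y (e (j, r)) ω) ∂P := by
        rw [lintegral_finsetSum _ fun j _ => Measurable.iSup fun r => (hY _).ennreal_ofReal]
        simp [hblock]
    _ ≤ _ := lintegral_mono fun ω =>
        sum_iSup_block_le_sum_kMax (fun i => Y i ω) (fun i => hY0 i ω) e heinj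

end Probability

/-! ### The support function -/

theorem ofReal_supportK {n N ℓ : ℕ} (hℓN : ℓ ≤ N) {q : ℝ} (hq : 1 ≤ q)
    (x : Fin N → EuclideanSpace ℝ (Fin n)) (θ : EuclideanSpace ℝ (Fin n)) :
    ENNReal.ofReal (supportK ℓ q x θ) =
      ((ℓ : ℝ≥0∞)⁻¹ * ENNReal.ofReal
        (∑ k ∈ (Finset.univ : Finset (Fin N)).filter (fun k => k.val < ℓ),
          kMax (fun i => |inner ℝ (x i) θ| ^ q) k)) ^ (1 / q) := by
  obtain ⟨A, -, hs⟩ := exists_card_eq_and_sum_kMax_eq hℓN (fun i => |inner ℝ (x i) θ| ^ q)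
  have h0 : 0 ≤ ∑ k ∈ (Finset.univ : Finset (Fin N)).filter (fun k => k.val < ℓ),
      kMax (fun i => |inner ℝ (x i) θ| ^ q) k := by
    rw [hs]; positivity
  unfold supportK
  rw [← ENNReal.ofReal_rpow_of_nonneg (by positivity) (by positivity),
    ENNReal.ofReal_mul (by positivity)]
  rcases Nat.eq_zero_or_pos ℓ with h | h
  · subst h
    simp
  · rw [one_div (ℓ : ℝ), ENNReal.ofReal_inv_of_pos (by positivity), ENNReal.ofReal_natCast]

theorem supportK_one_le_supportK {n N ℓ : ℕ} (hℓ : 1 ≤ ℓ) (hℓN : ℓ ≤ N) {q : ℝ} (hq : 1 ≤ q)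
    (x : Fin N → EuclideanSpace ℝ (Fin n)) (θ : EuclideanSpace ℝ (Fin n)) :
    supportK ℓ 1 x θ ≤ supportK ℓ q x θ := by
  obtain ⟨A, hA, hs⟩ := exists_card_eq_and_sum_kMax_eq hℓN (fun i => |inner ℝ (x i) θ|)
  have hle := sum_le_sum_kMax (fun i => |inner ℝ (x i) θ| ^ q) A hA
  have hℓ0 : (ℓ : ℝ) ≠ 0 := by positivity
  unfold supportK
  simp only [Real.rpow_one, div_one, hs]
  rw [Finset.mul_sum]
  refine (Real.arith_mean_le_rpow_mean A (fun _ => 1 / (ℓ : ℝ)) _ (fun _ _ => by positivity)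
    (by simp [hA, hℓ0]) (fun _ _ => abs_nonneg _) hq).trans ?_
  rw [← Finset.mul_sum]
  gcongr

theorem mainTheorem3 :
    ∃ c C : ℝ≥0, 0 < c ∧ 0 < C ∧
      ∀ (Ω : Type*) [MeasurableSpace Ω] (P : Measure Ω) [IsProbabilityMeasure P]
        (n N ℓ : ℕ) (q : ℝ) (X : Fin N → Ω → EuclideanSpace ℝ (Fin n))
        (θ : EuclideanSpace ℝ (Fin n)),
        (∀ i, Measurable (X i)) →
        iIndepFun X P →
        (∀ i j, IdentDistrib (X i) (X j) P P) →
        1 ≤ q → 1 ≤ ℓ → ℓ ≤ N → ‖θ‖ = 1 →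
          (c : ℝ≥0∞) * ∫⁻ ω, maxFirst ⌊(N : ℝ) / ℓ⌋₊ (fun i => |inner ℝ (X i ω) θ|) ∂P
              ≤ ∫⁻ ω, ENNReal.ofReal (supportK ℓ 1 (fun i => X i ω) θ) ∂P ∧
          ∫⁻ ω, ENNReal.ofReal (supportK ℓ 1 (fun i => X i ω) θ) ∂P
              ≤ ∫⁻ ω, ENNReal.ofReal (supportK ℓ q (fun i => X i ω) θ) ∂P ∧
          ∫⁻ ω, ENNReal.ofReal (supportK ℓ q (fun i => X i ω) θ) ∂P
              ≤ (C : ℝ≥0∞) *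
                (∫⁻ ω, maxFirst ⌈(N : ℝ) / ℓ⌉₊ (fun i => |inner ℝ (X i ω) θ| ^ q) ∂P)
                  ^ (1 / q) := by
  refine ⟨1, 2, one_pos, two_pos, fun Ω _ P _ n N ℓ q X θ hX hind hid hq hℓ hℓN _ => ?_⟩
  have hℓR : (0 : ℝ) < ℓ := by exact_mod_cast hℓ
  have hℓ0 : (ℓ : ℝ≥0∞) ≠ 0 := by exact_mod_cast (by omega : ℓ ≠ 0)
  have hℓt : (ℓ : ℝ≥0∞) ≠ ∞ := ENNReal.natCast_ne_top ℓ
  -- `q`-th powers of the marginals are again independent with a common tail function.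
  have hg : ∀ r : ℝ, Measurable fun x : EuclideanSpace ℝ (Fin n) => |inner ℝ x θ| ^ r :=
    fun r => by fun_prop
  have hYm : ∀ (r : ℝ) (i : Fin N), Measurable fun ω => |inner ℝ (X i ω) θ| ^ r :=
    fun r i => (hg r).comp (hX i)
  have hYind : ∀ r : ℝ, iIndepFun (fun i ω => |inner ℝ (X i ω) θ| ^ r) P :=
    fun r => hind.comp (fun _ x => |inner ℝ x θ| ^ r) fun _ => hg r
  let i₀ : Fin N := ⟨0, by omega⟩
  have hYp : ∀ (r : ℝ) (i : Fin N) (s : ℝ), P {ω | s < |inner ℝ (X i ω) θ| ^ r} =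
      P {ω | s < |inner ℝ (X i₀ ω) θ| ^ r} :=
    fun r i s => ((hid i i₀).comp (hg r)).measure_mem_eq measurableSet_Ioi
  refine ⟨?_, ?_, ?_⟩
  · set m := ⌊(N : ℝ) / ℓ⌋₊ with hm
    have hmN : m * ℓ ≤ N := by
      have h := Nat.floor_le (by positivity : (0 : ℝ) ≤ (N : ℝ) / ℓ)
      rw [le_div_iff₀ hℓR] at h
      exact_mod_cast h
    have h := lintegral_maxFirst_le_lintegral_sum_kMax hℓ hmN (hYm 1)
      (fun i ω => by positivity) (hYind 1) (hYp 1)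
    simp only [ofReal_supportK hℓN le_rfl, div_one, ENNReal.rpow_one]
    rw [lintegral_const_mul' _ _ (ENNReal.inv_ne_top.mpr hℓ0), ENNReal.coe_one, one_mul]
    simp only [Real.rpow_one] at h ⊢
    rwa [← ENNReal.div_eq_inv_mul, ENNReal.le_div_iff_mul_le (.inl hℓ0) (.inl hℓt), mul_comm]
  · exact lintegral_mono fun ω =>
      ENNReal.ofReal_le_ofReal (supportK_one_le_supportK hℓ hℓN hq _ _)
  · set M := ⌈(N : ℝ) / ℓ⌉₊ with hM
    have hNM : N ≤ M * ℓ := by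
      have h := Nat.le_ceil ((N : ℝ) / ℓ)
      rw [div_le_iff₀ hℓR] at h
      exact_mod_cast h
    have hMN : M ≤ N := Nat.ceil_le.mpr (div_le_self (by positivity) (by exact_mod_cast hℓ))
    set p : ℝ → ℝ≥0∞ := fun s => P {ω | s < |inner ℝ (X i₀ ω) θ| ^ q}
    have hcount := lintegral_min_count_le hNM (hYm q) (hYp q)
    have hmax : ∫⁻ ω, maxFirst M (fun i => |inner ℝ (X i ω) θ| ^ q) ∂P =
        ∫⁻ s in Set.Ioi (0 : ℝ), (1 - (1 - p s) ^ M) := by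
      simp only [maxFirst_eq_iSup_castLE hMN]
      rw [lintegral_iSup_ofReal_eq (W := fun r ω => |inner ℝ (X (Fin.castLE hMN r) ω) θ| ^ q)
        (fun r => hYm q _) ((hYind q).precomp (Fin.castLE_injective hMN)) (fun r => hYp q _),
        Fintype.card_fin]
    -- A measurable majorant of the `q`-th power of the support function.
    set G : Ω → ℝ≥0∞ := fun ω => (ℓ : ℝ≥0∞)⁻¹ * ∫⁻ s in Set.Ioi (0 : ℝ),
      min (ℓ : ℝ≥0∞) (countAbove (fun i => |inner ℝ (X i ω) θ| ^ q) s) with hG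
    have hGm : Measurable G :=
      (measurable_min_countAbove ℓ (hYm q)).lintegral_prod_right'.const_mul _
    have hGint : ∫⁻ ω, G ω ∂P ≤
        2 * ∫⁻ ω, maxFirst M (fun i => |inner ℝ (X i ω) θ| ^ q) ∂P := by
      rw [hG, lintegral_const_mul' _ _ (ENNReal.inv_ne_top.mpr hℓ0), hmax,
        ← lintegral_const_mul' _ _ ENNReal.ofNat_ne_top]
      calc _ ≤ (ℓ : ℝ≥0∞)⁻¹ * (ℓ * ∫⁻ s in Set.Ioi (0 : ℝ), min 1 (M * p s)) := by gcongr
        _ = ∫⁻ s in Set.Ioi (0 : ℝ), min 1 (M * p s) := by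
          rw [← mul_assoc, ENNReal.inv_mul_cancel hℓ0 hℓt, one_mul]
        _ ≤ _ := lintegral_mono fun s => min_one_mul_le_two_mul_one_sub_pow M prob_le_one
    have h1q : 1 / q ≤ 1 := (div_le_one (by positivity)).mpr hq
    calc ∫⁻ ω, ENNReal.ofReal (supportK ℓ q (fun i => X i ω) θ) ∂P
        ≤ ∫⁻ ω, G ω ^ (1 / q) ∂P := by
          refine lintegral_mono fun ω => ?_
          simp only [ofReal_supportK hℓN hq]
          exact ENNReal.rpow_le_rpow (mul_le_mul' le_rfl
            (ofReal_sum_kMax_le_lintegral_min hℓN _ fun i => by positivity)) (by positivity)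
      _ ≤ (∫⁻ ω, G ω ∂P) ^ (1 / q) := lintegral_rpow_one_div_le hGm hq
      _ ≤ (2 * ∫⁻ ω, maxFirst M (fun i => |inner ℝ (X i ω) θ| ^ q) ∂P) ^ (1 / q) := by gcongr
      _ = 2 ^ (1 / q) * (∫⁻ ω, maxFirst M (fun i => |inner ℝ (X i ω) θ| ^ q) ∂P) ^ (1 / q) :=
          ENNReal.mul_rpow_of_nonneg _ _ (by positivity)
      _ ≤ _ := by
          gcongr
          exact (ENNReal.rpow_le_rpow_of_exponent_le one_le_two h1q).trans (by simp)
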